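/- Let $\mathcal H$ be a real Hilbert space, let $\beta,\mu\in\left]0,+\infty\right[$, let $A\colon\mathcal H\to 2^{\mathcal H}$ be maximally monotone, let $B\colon\mathcal H\to\mathcal H$ be monotone and $\mu$-Lipschitzian, and let $C\colon\mathcal H\to\mathcal H$ be $\beta$-cocoercive, i.e. $\langle x-y, Cx-Cy\rangle\ge\beta\|Cx-Cy\|^2$ for all $x,y\in\mathcal H$. Suppose that $\operatorname{zer}(A+B+C)=\{x\in\mathcal H : 0\in Ax+Bx+Cx\}$ is nonempty. Let $\zeta\in\left]0,1/2\right[$, let $\xi\in\left]0,+\infty\right[$, and let $\gamma>0$ be such that $$\gamma<\frac{1-\zeta}{\mu},\qquad \gamma<\frac{4\beta\zeta}{1+\xi},\qquad \gamma<\frac{\sqrt2-1}{\mu},\qquad \gamma<\frac{1-2\zeta}{\mu(\sqrt2+1)+2/(\beta\xi)}.$$ Let $(x_0,x_{-1})\in\mathcal H^2$ and let $(x_n)_{n\in\mathbb N}$ be generated by $$(\forall n\in\mathbb N)\qquad y_n=2x_n-x_{n-1},\qquad x_{n+1}=J_{\gamma A}\big(x_n-\gamma By_n-\gamma Cx_n\big),$$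 where $J_{\gamma A}=(\operatorname{Id}+\gamma A)^{-1}$ is the resolvent of $\gamma A$. Then $(x_n)_{n\in\mathbb N}$ converges weakly to some $\overline x\in\operatorname{zer}(A+B+C)$. -/

import Mathlib

open Filter Topology
open scoped Pointwise NNReal

namespace MonotoneOperator

variable {H : Type*} [NormedAddCommGroup H] [InnerProductSpace ℝ H]

/-- The graph of a set-valued operator `A : H → 2^H`. Sums and scalar multiples of set-valued
operators are the pointwise Minkowski ones: `(A + B) x = A x + B x`, `(γ • A) x = γ • A x`. -/
def graph (A : H → Set H) : Set (H × H) := {p | p.2 ∈ A p.1}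

/-- The inverse `A⁻¹ : u ↦ {x | u ∈ A x}` of a set-valued operator. -/
def inverse (A : H → Set H) : H → Set H := fun u => {x | u ∈ A x}

/-- The zero set `zer A = A⁻¹ 0`. -/
def zer (A : H → Set H) : Set H := inverse A 0

/-- A single-valued operator, regarded as a set-valued one. -/
def ofFun (T : H → H) : H → Set H := fun x => {T x}

/-- Monotonicity: `⟪x - y, u - v⟫ ≥ 0` for all `(x, u)` and `(y, v)` in the graph. -/
def IsMonotone (A : H → Set H) : Prop :=
  ∀ x u y v : H, u ∈ A x → v ∈ A y → 0 ≤ inner ℝ (x - y) (u - v)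

/-- Maximal monotonicity: `A` is monotone and no monotone operator has a graph that properly
contains the graph of `A`. -/
def IsMaximallyMonotone (A : H → Set H) : Prop :=
  IsMonotone A ∧ ¬ ∃ A' : H → Set H, IsMonotone A' ∧ graph A ⊂ graph A'

/-- The resolvent `J_A = (Id + A)⁻¹`, as a set-valued operator. -/
def resolvent (A : H → Set H) : H → Set H := inverse (ofFun id + A)

/-- `β`-cocoercivity of a single-valued operator. -/
def IsCocoercive (β : ℝ) (C : H → H) : Prop :=
  ∀ x y : H, β * ‖C x - C y‖ ^ 2 ≤ inner ℝ (x - y) (C x - C y)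

end MonotoneOperator

/-!
Testing the monotonicity of `A` at `x (n + 2)` against a zero `z` and against the previous iterate
`x (n + 1)`, and adding the two inequalities, shows that `‖x (n + 1) - z‖ ^ 2` plus correction terms
decreases by a multiple `δ` of `‖x (n + 2) - x (n + 1)‖ ^ 2` at each step. Here `δ > 0` as soon as
`γ * (μ * (√2 + 1)) + 5 / 2 * (γ / β) < 1`, and the conditions on `ζ` and `ξ` imply this (`ξ = 2` is
the best choice). Hence the steps tend to zero, the correction terms vanish, and `‖x n - z‖`
converges for every zero `z`.

The resolvent inclusion writes a vanishing residual as a point of `A (x (n + 1))` plus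
`(B + C) (x (n + 1))`. In a weak cluster point, maximality of `A` and of the Lipschitz monotone
operator `B + C` separately suffices to pass to the limit: along an ultrafilter the pairings of
`x (n + 1)` with the two summands converge to opposite numbers. So every weak cluster point is a
zero, and Opial's lemma concludes.
-/

namespace MonotoneOperator

variable {ι H : Type*} [NormedAddCommGroup H] [InnerProductSpace ℝ H]

section WeakConvergence

lemma continuous_inner_toWeakSpace_symm (h : H) :
    Continuous fun p : WeakSpace ℝ H => inner ℝ ((toWeakSpace ℝ H).symm p) h := by
  simp only [real_inner_comm h]
  exact WeakBilin.eval_continuous (topDualPairing ℝ H).flip (innerSL ℝ h)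

lemma tendsto_inner_of_tendsto_toWeakSpace {l : Filter ι} {x : ι → H} {w : H}
    (hx : Tendsto (fun i => toWeakSpace ℝ H (x i)) l (𝓝 (toWeakSpace ℝ H w))) (h : H) :
    Tendsto (fun i => inner ℝ (x i) h) l (𝓝 (inner ℝ w h)) :=
  ((continuous_inner_toWeakSpace_symm h).tendsto _).comp hx

-- The Riesz isomorphism carries the weak-* topology of the dual to the weak topology of the space.
lemma isCompact_toWeakSpace_image_closedBall [CompleteSpace H] (z : H) (r : ℝ) :
    IsCompact (toWeakSpace ℝ H '' Metric.closedBall z r) := by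
  let riesz := InnerProductSpace.toDual ℝ H
  have hcont : Continuous fun f : WeakDual ℝ H =>
      toWeakSpace ℝ H (riesz.symm (WeakDual.toStrongDual f)) := by
    refine WeakBilin.continuous_of_continuous_eval _ fun g => ?_
    refine (WeakDual.eval_continuous (riesz.symm g)).congr fun f => ?_
    change WeakDual.toStrongDual f (riesz.symm g) = g (riesz.symm (WeakDual.toStrongDual f))
    rw [← InnerProductSpace.toDual_symm_apply (𝕜 := ℝ), real_inner_comm,
      InnerProductSpace.toDual_symm_apply]
  have hball : Metric.closedBall z r = riesz.symm '' Metric.closedBall (riesz z) r := by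
    rw [LinearIsometryEquiv.image_closedBall, riesz.symm_apply_apply]
  rw [hball, Set.image_image]
  exact (WeakDual.isCompact_closedBall (riesz z) r).image hcont

lemma exists_tendsto_of_isBounded_range {E : Type*} [PseudoMetricSpace E] [ProperSpace E]
    (U : Ultrafilter ι) {s : ι → E} (hs : Bornology.IsBounded (Set.range s)) :
    ∃ c, Tendsto s U (𝓝 c) := by
  obtain ⟨c, -, hc⟩ := hs.isCompact_closure.ultrafilter_le_nhds (U.map s) <|
    tendsto_principal.2 (Eventually.of_forall fun i => subset_closure (Set.mem_range_self i))
  exact ⟨c, hc⟩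

lemma exists_tendsto_toWeakSpace_of_isBounded_range [CompleteSpace H] (U : Ultrafilter ι)
    {x : ι → H} (hx : Bornology.IsBounded (Set.range x)) :
    ∃ w, Tendsto (fun i => toWeakSpace ℝ H (x i)) U (𝓝 (toWeakSpace ℝ H w)) := by
  obtain ⟨r, hr⟩ := hx.subset_closedBall 0
  have hmem : ∀ᶠ i in U, toWeakSpace ℝ H (x i) ∈ toWeakSpace ℝ H '' Metric.closedBall 0 r :=
    Eventually.of_forall fun i => ⟨x i, hr (Set.mem_range_self i), rfl⟩
  obtain ⟨_, ⟨w, -, rfl⟩, hw⟩ :=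
    (isCompact_toWeakSpace_image_closedBall (0 : H) r).ultrafilter_le_nhds
      (U.map fun i => toWeakSpace ℝ H (x i)) (tendsto_principal.2 hmem)
  exact ⟨w, hw⟩

lemma eq_of_mapClusterPt_of_tendsto_norm_sub {l : Filter ι} {x : ι → H} {w w' : H} {r r' : ℝ}
    (hw : MapClusterPt (toWeakSpace ℝ H w) l fun i => toWeakSpace ℝ H (x i))
    (hw' : MapClusterPt (toWeakSpace ℝ H w') l fun i => toWeakSpace ℝ H (x i))
    (hr : Tendsto (fun i => ‖x i - w‖) l (𝓝 r)) (hr' : Tendsto (fun i => ‖x i - w'‖) l (𝓝 r')) :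
    w = w' := by
  have hlim : Tendsto (fun i => inner ℝ (x i) (w - w')) l
      (𝓝 ((r' ^ 2 - r ^ 2 + ‖w‖ ^ 2 - ‖w'‖ ^ 2) / 2)) := by
    refine (((((hr'.pow 2).sub (hr.pow 2)).add_const (‖w‖ ^ 2)).sub_const
      (‖w'‖ ^ 2)).div_const 2).congr fun i => ?_
    rw [norm_sub_sq_real, norm_sub_sq_real, inner_sub_right]
    ring
  have hinner : ∀ v, MapClusterPt (toWeakSpace ℝ H v) l (fun i => toWeakSpace ℝ H (x i)) →
      inner ℝ v (w - w') = (r' ^ 2 - r ^ 2 + ‖w‖ ^ 2 - ‖w'‖ ^ 2) / 2 := fun v hv =>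
    have hv' := hv.continuousAt_comp (continuous_inner_toWeakSpace_symm (w - w')).continuousAt
    eq_of_nhds_neBot (hv'.clusterPt.mono hlim)
  have hself : inner ℝ (w - w') (w - w') = 0 := by
    rw [inner_sub_left, hinner w hw, hinner w' hw', sub_self]
  exact sub_eq_zero.1 (inner_self_eq_zero.1 hself)

/-- Opial's lemma. -/
lemma exists_tendsto_toWeakSpace_of_tendsto_norm_sub [CompleteSpace H] {l : Filter ι} [NeBot l]
    {x : ι → H} {Z : Set H} (hZ : Z.Nonempty)
    (hlim : ∀ z ∈ Z, ∃ r, Tendsto (fun i => ‖x i - z‖) l (𝓝 r))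
    (hcluster : ∀ w, MapClusterPt (toWeakSpace ℝ H w) l (fun i => toWeakSpace ℝ H (x i)) →
      w ∈ Z) :
    ∃ w ∈ Z, Tendsto (fun i => toWeakSpace ℝ H (x i)) l (𝓝 (toWeakSpace ℝ H w)) := by
  obtain ⟨z, hz⟩ := hZ
  obtain ⟨r, hr⟩ := hlim z hz
  have hK := isCompact_toWeakSpace_image_closedBall z (r + 1)
  have hxK : ∀ᶠ i in l, toWeakSpace ℝ H (x i) ∈ toWeakSpace ℝ H '' Metric.closedBall z (r + 1) := by
    filter_upwards [hr.eventually_le_const (lt_add_one r)] with i hi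
    exact Set.mem_image_of_mem _ (mem_closedBall_iff_norm.2 hi)
  obtain ⟨_, ⟨w, -, rfl⟩, hw⟩ := hK.exists_mapClusterPt_of_frequently hxK.frequently
  refine ⟨w, hcluster w hw, hK.tendsto_nhds_of_unique_mapClusterPt hxK ?_⟩
  rintro _ ⟨w', -, rfl⟩ hw'
  obtain ⟨s, hs⟩ := hlim w (hcluster w hw)
  obtain ⟨s', hs'⟩ := hlim w' (hcluster w' hw')
  rw [eq_of_mapClusterPt_of_tendsto_norm_sub hw hw' hs hs']

end WeakConvergence

section SetValued

variable {A D : H → Set H} {l : Filter ι} {x u : ι → H} {w v : H} {s : ℝ}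

lemma IsMaximallyMonotone.mem_of_forall_inner_nonneg (hA : IsMaximallyMonotone A)
    (h : ∀ z u, u ∈ A z → 0 ≤ inner ℝ (w - z) (v - u)) : v ∈ A w := by
  by_contra hv
  refine hA.2 ⟨fun z => {u | u ∈ A z ∨ z = w ∧ u = v}, ?_, fun p hp => Or.inl hp,
    fun hsub => hv (@hsub (w, v) (Or.inr ⟨rfl, rfl⟩))⟩
  rintro a u b u' (ha | ⟨rfl, rfl⟩) (hb | ⟨rfl, rfl⟩)
  · exact hA.1 _ _ _ _ ha hb
  · rw [← neg_sub b, ← neg_sub u', inner_neg_neg]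
    exact h _ _ ha
  · exact h _ _ hb
  · simp

-- Minty's trick: test monotonicity at `w - t • k` and let `t → 0⁺`.
lemma isMaximallyMonotone_ofFun {T : H → H} (hT : Continuous T) (hmono : IsMonotone (ofFun T)) :
    IsMaximallyMonotone (ofFun T) := by
  refine ⟨hmono, fun ⟨A', hA', hlt⟩ => hlt.2 ?_⟩
  rintro ⟨w, v⟩ (hv : v ∈ A' w)
  have hray (k : H) (t : ℝ) (ht : 0 < t) : 0 ≤ inner ℝ k (v - T (w - t • k)) := by
    have hmem : T (w - t • k) ∈ A' (w - t • k) := @hlt.1 (w - t • k, T (w - t • k)) rfl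
    have h := hA' _ _ _ _ hv hmem
    rw [sub_sub_cancel, real_inner_smul_left] at h
    exact nonneg_of_mul_nonneg_right h ht
  have hlim (k : H) : 0 ≤ inner ℝ k (v - T w) := by
    have hcont : Continuous fun t : ℝ => inner ℝ k (v - T (w - t • k)) := by fun_prop
    have h := (hcont.tendsto 0).mono_left (nhdsWithin_le_nhds (s := Set.Ioi 0))
    rw [zero_smul, sub_zero] at h
    exact ge_of_tendsto h (eventually_nhdsWithin_of_forall (hray k))
  have hnorm : inner ℝ (v - T w) (v - T w) ≤ 0 := by
    have h := hlim (-(v - T w))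
    rwa [inner_neg_left, neg_nonneg] at h
  exact sub_eq_zero.1 (real_inner_self_nonpos.1 hnorm)

lemma tendsto_inner_sub_sub
    (hx : Tendsto (fun i => toWeakSpace ℝ H (x i)) l (𝓝 (toWeakSpace ℝ H w)))
    (hu : Tendsto (fun i => toWeakSpace ℝ H (u i)) l (𝓝 (toWeakSpace ℝ H v)))
    (hs : Tendsto (fun i => inner ℝ (x i) (u i)) l (𝓝 s)) (p q : H) :
    Tendsto (fun i => inner ℝ (x i - p) (u i - q)) l
      (𝓝 (s - inner ℝ w q - inner ℝ v p + inner ℝ p q)) := by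
  refine (((hs.sub (tendsto_inner_of_tendsto_toWeakSpace hx q)).sub
    (tendsto_inner_of_tendsto_toWeakSpace hu p)).add_const (inner ℝ p q)).congr fun i => ?_
  simp only [inner_sub_left, inner_sub_right, real_inner_comm p (u i)]
  ring

lemma IsMonotone.inner_le_of_tendsto [NeBot l] (hA : IsMonotone A) (hmem : ∀ i, u i ∈ A (x i))
    (hx : Tendsto (fun i => toWeakSpace ℝ H (x i)) l (𝓝 (toWeakSpace ℝ H w)))
    (hu : Tendsto (fun i => toWeakSpace ℝ H (u i)) l (𝓝 (toWeakSpace ℝ H v)))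
    (hs : Tendsto (fun i => inner ℝ (x i) (u i)) l (𝓝 s)) (hv : v ∈ A w) :
    inner ℝ w v ≤ s := by
  have h := ge_of_tendsto' (tendsto_inner_sub_sub hx hu hs w v) fun i => hA _ _ _ _ (hmem i) hv
  linarith [real_inner_comm v w]

lemma IsMaximallyMonotone.mem_of_tendsto [NeBot l] (hA : IsMaximallyMonotone A)
    (hmem : ∀ i, u i ∈ A (x i))
    (hx : Tendsto (fun i => toWeakSpace ℝ H (x i)) l (𝓝 (toWeakSpace ℝ H w)))
    (hu : Tendsto (fun i => toWeakSpace ℝ H (u i)) l (𝓝 (toWeakSpace ℝ H v)))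
    (hs : Tendsto (fun i => inner ℝ (x i) (u i)) l (𝓝 s)) (hsv : s ≤ inner ℝ w v) :
    v ∈ A w := by
  refine hA.mem_of_forall_inner_nonneg fun p q hq => ?_
  have h := ge_of_tendsto' (tendsto_inner_sub_sub hx hu hs p q) fun i =>
    hA.1 _ _ _ _ (hmem i) hq
  simp only [inner_sub_left, inner_sub_right]
  linarith [real_inner_comm v p]

/-- Of the limits `s` and `-s` of the two pairings at least one is small enough to put its limit
point in the graph; monotonicity then makes it equal to `±⟪w, v⟫`, which settles the other. -/
lemma IsMaximallyMonotone.neg_mem_and_mem_of_tendsto_add [NeBot l]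
    (hA : IsMaximallyMonotone A) (hD : IsMaximallyMonotone D) {d a : ι → H}
    (ha : ∀ i, a i ∈ A (x i)) (hd : ∀ i, d i ∈ D (x i))
    (hbdd : Bornology.IsBounded (Set.range x)) (hsum : Tendsto (fun i => a i + d i) l (𝓝 0))
    (hx : Tendsto (fun i => toWeakSpace ℝ H (x i)) l (𝓝 (toWeakSpace ℝ H w)))
    (hdv : Tendsto (fun i => toWeakSpace ℝ H (d i)) l (𝓝 (toWeakSpace ℝ H v)))
    (hs : Tendsto (fun i => inner ℝ (x i) (d i)) l (𝓝 s)) :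
    -v ∈ A w ∧ v ∈ D w := by
  have hav : Tendsto (fun i => toWeakSpace ℝ H (a i)) l (𝓝 (toWeakSpace ℝ H (-v))) := by
    have h := (((toWeakSpaceCLM ℝ H).continuous.tendsto 0).comp hsum).sub hdv
    rw [map_zero, zero_sub, ← map_neg] at h
    refine h.congr fun i => ?_
    rw [Function.comp_apply, toWeakSpaceCLM_eq_toWeakSpace, ← map_sub, add_sub_cancel_right]
  have has : Tendsto (fun i => inner ℝ (x i) (a i)) l (𝓝 (-s)) := by
    have h : Tendsto (fun i => inner ℝ (x i) (a i + d i)) l (𝓝 0) := by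
      obtain ⟨r, hr⟩ := hbdd.exists_norm_le
      refine squeeze_zero_norm (a := fun i => r * ‖a i + d i‖) (fun i => ?_) ?_
      · exact (norm_inner_le_norm _ _).trans
          (mul_le_mul_of_nonneg_right (hr _ (Set.mem_range_self i)) (norm_nonneg _))
      · simpa using hsum.norm.const_mul r
    simpa [inner_add_right] using h.sub hs
  have hAle := hA.1.inner_le_of_tendsto ha hx hav has
  have hDle := hD.1.inner_le_of_tendsto hd hx hdv hs
  have hAmem := hA.mem_of_tendsto ha hx hav has
  have hDmem := hD.mem_of_tendsto hd hx hdv hs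
  rw [inner_neg_right] at hAle hAmem
  rcases le_total s (inner ℝ w v) with h | h
  · have hv := hDmem h
    exact ⟨hAmem (neg_le_neg (hDle hv)), hv⟩
  · have hv := hAmem (neg_le_neg h)
    exact ⟨hv, hDmem (neg_le_neg_iff.1 (hAle hv))⟩

end SetValued

lemma IsMaximallyMonotone.neg_mem_of_mapClusterPt [CompleteSpace H] {A : H → Set H}
    (hA : IsMaximallyMonotone A) {T : H → H} (hmono : IsMonotone (ofFun T)) {K : ℝ≥0}
    (hT : LipschitzWith K T) {l : Filter ι} {x a : ι → H} {w : H} (ha : ∀ i, a i ∈ A (x i))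
    (hbdd : Bornology.IsBounded (Set.range x))
    (hsum : Tendsto (fun i => a i + T (x i)) l (𝓝 0))
    (hw : MapClusterPt (toWeakSpace ℝ H w) l fun i => toWeakSpace ℝ H (x i)) :
    -T w ∈ A w := by
  obtain ⟨U, hU, hxw⟩ := mapClusterPt_iff_ultrafilter.1 hw
  have hTbdd : Bornology.IsBounded (Set.range fun i => T (x i)) :=
    Set.range_comp T x ▸ hT.isBounded_image hbdd
  obtain ⟨v, hv⟩ := exists_tendsto_toWeakSpace_of_isBounded_range U hTbdd
  have hinner : Bornology.IsBounded (Set.range fun i => inner ℝ (x i) (T (x i))) := by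
    obtain ⟨r, hr⟩ := hbdd.exists_norm_le
    obtain ⟨r', hr'⟩ := hTbdd.exists_norm_le
    refine (isBounded_iff_forall_norm_le.2 ⟨r * r', Set.forall_mem_range.2 fun i => ?_⟩)
    exact (norm_inner_le_norm _ _).trans (mul_le_mul (hr _ (Set.mem_range_self i))
      (hr' _ (Set.mem_range_self i)) (norm_nonneg _)
      ((norm_nonneg _).trans (hr _ (Set.mem_range_self i))))
  obtain ⟨s, hs⟩ := exists_tendsto_of_isBounded_range U hinner
  obtain ⟨hvA, rfl⟩ := hA.neg_mem_and_mem_of_tendsto_add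
    (isMaximallyMonotone_ofFun hT.continuous hmono) ha (fun _ => rfl) hbdd (hsum.mono_left hU)
    hxw hv hs
  exact hvA

section Real

/- `1 / (√2 + 1) = √2 - 1`, so the products `a * p` and `a * q` are bounded by squares in which
`a ^ 2` has the total weight `(√2 - 1) + 1`. -/
lemma two_mul_mul_add_le_sqrt_two (a p q : ℝ) :
    2 * (a * (p + q)) ≤ √2 * a ^ 2 + (√2 + 1) * p ^ 2 + q ^ 2 := by
  have hsqrt : √2 * √2 = 2 := Real.mul_self_sqrt two_pos.le
  have hp : 0 ≤ (√2 + 1) * (p - (√2 - 1) * a) ^ 2 := by positivity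
  have hexpand : (√2 + 1) * (p - (√2 - 1) * a) ^ 2 =
      (√2 + 1) * p ^ 2 - 2 * (√2 * √2 - 1) * (a * p) + (√2 * √2 - 1) * (√2 - 1) * a ^ 2 := by
    ring
  rw [hsqrt] at hexpand
  linarith [two_mul_le_add_sq a q]

lemma tendsto_of_succ_add_le {V s : ℕ → ℝ} (hV : ∀ n, 0 ≤ V n) (hs : ∀ n, 0 ≤ s n)
    (h : ∀ n, V (n + 1) + s n ≤ V n) :
    (∃ c, Tendsto V atTop (𝓝 c)) ∧ Tendsto s atTop (𝓝 0) := by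
  have hanti : Antitone V := antitone_nat_of_succ_le fun n => by linarith [h n, hs n]
  have hlim := tendsto_atTop_ciInf hanti ⟨0, Set.forall_mem_range.2 hV⟩
  have hdiff : Tendsto (fun n => V n - V (n + 1)) atTop (𝓝 0) := by
    simpa using hlim.sub ((tendsto_add_atTop_iff_nat 1).2 hlim)
  exact ⟨⟨_, hlim⟩, squeeze_zero hs (fun n => by linarith [h n]) hdiff⟩

-- Add the bound on `γ * m` to half the bound on `γ / β`; `ζ` cancels and `ξ / 2 + 2 / ξ ≥ 2`.
lemma mul_add_lt_one_of_lt_div {m β ζ ξ γ : ℝ} (hm : 0 ≤ m) (hβ : 0 < β) (hξ : 0 < ξ) (hγ : 0 < γ)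
    (hγβ : γ < 4 * β * ζ / (1 + ξ)) (hγm : γ < (1 - 2 * ζ) / (m + 2 / (β * ξ))) :
    γ * m + 5 / 2 * (γ / β) < 1 := by
  have hζ : γ / β * (1 + ξ) < 4 * ζ := by
    rw [lt_div_iff₀ (by positivity)] at hγβ
    rw [div_mul_eq_mul_div, div_lt_iff₀ hβ]
    linarith
  have hsum : γ * m + γ / β * (2 / ξ) < 1 - 2 * ζ := by
    rw [lt_div_iff₀ (by positivity), mul_add] at hγm
    rwa [div_mul_div_comm, mul_div_assoc]
  have hξ' : 2 ≤ ξ / 2 + 2 / ξ := by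
    have hsq : ξ / 2 + 2 / ξ - 2 = (ξ - 2) ^ 2 / (2 * ξ) := by
      field_simp
      ring
    have hnonneg : 0 ≤ (ξ - 2) ^ 2 / (2 * ξ) := by positivity
    linarith
  linarith [mul_le_mul_of_nonneg_left hξ' (div_pos hγ hβ).le]

lemma mul_lt_one_of_mul_add_lt_one {β γ μ : ℝ} (hβ : 0 < β) (hγ : 0 < γ) (hμ : 0 ≤ μ)
    (hstep : γ * (μ * (√2 + 1)) + 5 / 2 * (γ / β) < 1) : γ * μ < 1 := by
  linarith [mul_nonneg (mul_nonneg hγ.le hμ) (Real.sqrt_nonneg 2), div_pos hγ hβ]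

end Real

section Operators

variable {A : H → Set H} {B C : H → H} {β γ : ℝ} {μ : ℝ≥0}

lemma mem_resolvent_smul_iff (hγ : γ ≠ 0) {p w : H} :
    p ∈ resolvent (γ • A) w ↔ γ⁻¹ • (w - p) ∈ A p := by
  change w ∈ ({p} : Set H) + γ • A p ↔ _
  rw [Set.singleton_add, Set.image_add_left, Set.mem_preimage, neg_add_eq_sub,
    Set.mem_smul_set_iff_inv_smul_mem₀ hγ]

lemma mem_zer_add_ofFun_add_ofFun_iff {E : Type*} [NormedAddCommGroup E] {A : E → Set E}
    {B C : E → E} {z : E} : z ∈ zer (A + ofFun B + ofFun C) ↔ -(B z + C z) ∈ A z := by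
  change (0 : E) ∈ A z + {B z} + {C z} ↔ _
  rw [add_assoc, Set.singleton_add_singleton, Set.add_singleton, Set.image_add_right,
    Set.mem_preimage, zero_add]

-- Three-point identity for `q - γ • g - p`, plus monotonicity of `A`.
lemma IsMonotone.norm_sub_sq_add_norm_sub_sq_le (hA : IsMonotone A) (hγ : 0 < γ) {p q g z u : H}
    (hp : p ∈ resolvent (γ • A) (q - γ • g)) (hu : u ∈ A z) :
    ‖p - z‖ ^ 2 + ‖p - q‖ ^ 2 ≤ ‖q - z‖ ^ 2 - 2 * γ * inner ℝ (p - z) (g + u) := by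
  have hmono := hA _ _ _ _ ((mem_resolvent_smul_iff hγ.ne').1 hp) hu
  have hscaled := mul_nonneg hγ.le hmono
  rw [← real_inner_smul_right, smul_sub, smul_inv_smul₀ hγ.ne'] at hscaled
  have hnorm : ‖q - z‖ ^ 2 = ‖p - z‖ ^ 2 - 2 * inner ℝ (p - z) (p - q) + ‖p - q‖ ^ 2 := by
    rw [← norm_sub_sq_real, sub_sub_sub_cancel_left]
  have hsplit : q - γ • g - p - γ • u = -((p - q) + γ • (g + u)) := by
    rw [smul_add]
    abel
  rw [hsplit, inner_neg_right, inner_add_right, real_inner_smul_right] at hscaled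
  linarith

lemma IsCocoercive.isMonotone (hC : IsCocoercive β C) (hβ : 0 ≤ β) : IsMonotone (ofFun C) := by
  rintro x _ y _ rfl rfl
  exact (mul_nonneg hβ (sq_nonneg _)).trans (hC x y)

lemma IsMonotone.ofFun_add (hB : IsMonotone (ofFun B)) (hC : IsMonotone (ofFun C)) :
    IsMonotone (ofFun fun x => B x + C x) := by
  rintro x _ y _ rfl rfl
  rw [add_sub_add_comm, inner_add_right]
  exact add_nonneg (hB x _ y _ rfl rfl) (hC x _ y _ rfl rfl)

lemma abs_inner_sub_le_of_lipschitzWith (hB : LipschitzWith μ B) (v x y : H) :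
    |inner ℝ v (B x - B y)| ≤ μ * (‖v‖ * ‖x - y‖) :=
  calc |inner ℝ v (B x - B y)| ≤ ‖v‖ * ‖B x - B y‖ := abs_real_inner_le_norm _ _
    _ ≤ ‖v‖ * (μ * ‖x - y‖) := by
      gcongr
      exact hB.norm_sub_le x y
    _ = μ * (‖v‖ * ‖x - y‖) := mul_left_comm _ _ _

lemma IsCocoercive.mul_norm_sub_le (hC : IsCocoercive β C) (x y : H) :
    β * ‖C x - C y‖ ≤ ‖x - y‖ := by
  rcases (norm_nonneg (C x - C y)).eq_or_lt with h | h
  · rw [← h, mul_zero]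
    exact norm_nonneg _
  · refine le_of_mul_le_mul_right ?_ h
    rw [mul_assoc, ← sq]
    exact (hC x y).trans (real_inner_le_norm _ _)

lemma IsCocoercive.lipschitzWith (hC : IsCocoercive β C) (hβ : 0 < β) :
    LipschitzWith (Real.toNNReal β⁻¹) C :=
  LipschitzWith.of_dist_le' fun x y => by
    rw [dist_eq_norm, dist_eq_norm, le_inv_mul_iff₀ hβ]
    exact hC.mul_norm_sub_le x y

lemma IsCocoercive.neg_inner_sub_le_norm_sq_div (hC : IsCocoercive β C) (hβ : 0 < β) (p x y : H) :
    -inner ℝ (p - y) (C x - C y) ≤ ‖p - x‖ ^ 2 / (4 * β) := by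
  have hcs : -inner ℝ (p - x) (C x - C y) ≤ ‖p - x‖ * ‖C x - C y‖ :=
    (neg_le_abs _).trans (abs_real_inner_le_norm _ _)
  have hyoung : ‖p - x‖ * ‖C x - C y‖ ≤ ‖p - x‖ ^ 2 / (4 * β) + β * ‖C x - C y‖ ^ 2 := by
    have hsq : 0 ≤ (‖p - x‖ - 2 * β * ‖C x - C y‖) ^ 2 / (4 * β) := by positivity
    have hexpand : (‖p - x‖ - 2 * β * ‖C x - C y‖) ^ 2 / (4 * β) =
        ‖p - x‖ ^ 2 / (4 * β) + β * ‖C x - C y‖ ^ 2 - ‖p - x‖ * ‖C x - C y‖ := by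
      field_simp
      ring
    linarith
  rw [← sub_add_sub_cancel p x y, inner_add_left]
  linarith [hC x y]

lemma IsCocoercive.neg_inner_le_add_norm_sq_div (hC : IsCocoercive β C) (hβ : 0 < β) (v x y : H) :
    -inner ℝ v (C x - C y) ≤ (‖v‖ ^ 2 + ‖x - y‖ ^ 2) / (2 * β) := by
  have hlip := (neg_le_abs _).trans (abs_inner_sub_le_of_lipschitzWith (hC.lipschitzWith hβ) v x y)
  rw [Real.coe_toNNReal _ (inv_pos.2 hβ).le, ← div_eq_inv_mul] at hlip
  refine hlip.trans ?_
  rw [div_le_div_iff₀ hβ (by positivity)]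
  have hyoung := mul_le_mul_of_nonneg_right (two_mul_le_add_sq ‖v‖ ‖x - y‖) hβ.le
  linarith

-- `B` is monotone between `y₁ = x₂ - (x₂ - y₁)` and `z`, and Lipschitz between `y₁` and `y₀`.
lemma IsMonotone.neg_inner_add_inner_le (hB : IsMonotone (ofFun B)) (hBL : LipschitzWith μ B)
    {x₀ x₁ y₁ : H} (hy : y₁ = (2 : ℝ) • x₁ - x₀) (x₂ y₀ z : H) :
    -(2 * inner ℝ (x₂ - z) (B y₁ - B z) + 2 * inner ℝ (x₂ - x₁) (B y₁ - B y₀)) ≤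
      2 * inner ℝ (x₁ - x₀) (B y₀ - B z) - 2 * inner ℝ (x₂ - x₁) (B y₁ - B z)
        + μ * (√2 * ‖x₂ - y₁‖ ^ 2 + (√2 + 1) * ‖x₁ - x₀‖ ^ 2 + ‖x₁ - y₀‖ ^ 2) := by
  have hmono : 0 ≤ inner ℝ ((x₂ - z) - (x₂ - y₁)) (B y₁ - B z) := by
    rw [sub_sub_sub_cancel_left]
    exact hB y₁ _ z _ rfl rfl
  have hreflect : x₂ - x₁ = (x₂ - y₁) + (x₁ - x₀) := by
    rw [hy, two_smul]
    abel
  have hlip : -inner ℝ (x₂ - y₁) (B y₁ - B y₀) ≤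
      μ * (‖x₂ - y₁‖ * (‖x₁ - x₀‖ + ‖x₁ - y₀‖)) := by
    refine (neg_le_abs _).trans ((abs_inner_sub_le_of_lipschitzWith hBL _ _ _).trans ?_)
    have hsplit : y₁ - y₀ = (x₁ - x₀) + (x₁ - y₀) := by
      rw [hy, two_smul]
      abel
    rw [hsplit]
    gcongr
    exact norm_add_le _ _
  have hsq := mul_le_mul_of_nonneg_left
    (two_mul_mul_add_le_sqrt_two ‖x₂ - y₁‖ ‖x₁ - x₀‖ ‖x₁ - y₀‖) μ.coe_nonneg
  have hdiff : inner ℝ (x₁ - x₀) (B y₁ - B y₀) =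
      inner ℝ (x₁ - x₀) (B y₁ - B z) - inner ℝ (x₁ - x₀) (B y₀ - B z) := by
    rw [← inner_sub_right, sub_sub_sub_cancel_right]
  rw [hreflect, inner_add_left, inner_add_left, hdiff]
  rw [inner_sub_left] at hmono
  linarith

lemma tendsto_sub_of_lipschitzWith {E F : Type*} [SeminormedAddCommGroup E]
    [SeminormedAddCommGroup F] {K : ℝ≥0} {f : E → F} (hf : LipschitzWith K f) {l : Filter ι}
    {p q : ι → E} (hpq : Tendsto (fun i => p i - q i) l (𝓝 0)) :
    Tendsto (fun i => f (p i) - f (q i)) l (𝓝 0) :=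
  squeeze_zero_norm (fun i => hf.norm_sub_le (p i) (q i))
    (by simpa using hpq.norm.const_mul (K : ℝ))

end Operators

/-- The iterates `x` and reflected points `y` of the reflected forward-backward algorithm for
`A + B + C` with step size `γ`. The first reflected point `y 0` is arbitrary, which amounts to an
arbitrary choice of `x₋₁ = 2 x₀ - y₀`. -/
structure IsReflectedForwardBackward (A : H → Set H) (B C : H → H) (γ : ℝ) (x y : ℕ → H) :
    Prop where
  reflected_succ : ∀ n, y (n + 1) = (2 : ℝ) • x (n + 1) - x n
  succ_mem_resolvent : ∀ n, x (n + 1) ∈ resolvent (γ • A) (x n - γ • B (y n) - γ • C (x n))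

/-- The Lyapunov function of the reflected forward-backward iteration relative to a zero `z`. The
coefficients of the last two terms are those with which the Lipschitz error of `B` and the lagged
evaluation of `C` telescope. -/
noncomputable def lyapunov (B : H → H) (β γ μ : ℝ) (x y : ℕ → H) (z : H) (n : ℕ) : ℝ :=
  ‖x (n + 1) - z‖ ^ 2 + 2 * γ * inner ℝ (x (n + 1) - x n) (B (y n) - B z)
    + (1 + γ * μ * (√2 + 1) + γ / β) * ‖x (n + 1) - x n‖ ^ 2
    + γ * μ * ‖x (n + 1) - y n‖ ^ 2

lemma one_sub_mul_norm_sq_le_lyapunov {B : H → H} {β γ : ℝ} {μ : ℝ≥0} (hBL : LipschitzWith μ B)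
    (hβ : 0 < β) (hγ : 0 < γ) (x y : ℕ → H) (z : H) (n : ℕ) :
    (1 - γ * μ) * ‖x (n + 1) - z‖ ^ 2 ≤ lyapunov B β γ μ x y z n := by
  set d := x (n + 1) - x n
  set e := x (n + 1) - y n
  have hinner : -inner ℝ d (B (y n) - B z) ≤ μ * (‖d‖ * (‖x (n + 1) - z‖ + ‖e‖)) := by
    refine (neg_le_abs _).trans ((abs_inner_sub_le_of_lipschitzWith hBL _ _ _).trans ?_)
    rw [← sub_sub_sub_cancel_left z (y n) (x (n + 1))]
    gcongr
    exact norm_sub_le _ _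
  have hsq : 2 * (‖d‖ * (‖x (n + 1) - z‖ + ‖e‖)) ≤
      2 * ‖d‖ ^ 2 + ‖x (n + 1) - z‖ ^ 2 + ‖e‖ ^ 2 := by
    linarith [two_mul_le_add_sq ‖d‖ ‖x (n + 1) - z‖, two_mul_le_add_sq ‖d‖ ‖e‖]
  have hγμ : 0 ≤ γ * μ := mul_nonneg hγ.le μ.coe_nonneg
  have hcoeff : γ * μ * 2 ≤ 1 + γ * μ * (√2 + 1) + γ / β := by
    have hsqrt : 2 ≤ √2 + 1 := by linarith [Real.one_le_sqrt.2 one_le_two]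
    linarith [mul_le_mul_of_nonneg_left hsqrt hγμ, div_pos hγ hβ]
  have hinner' := mul_le_mul_of_nonneg_left hinner hγ.le
  have hsq' := mul_le_mul_of_nonneg_left hsq hγμ
  have hcoeff' := mul_le_mul_of_nonneg_right hcoeff (sq_nonneg ‖d‖)
  unfold lyapunov
  linarith

lemma isBounded_range_of_tendsto_lyapunov {B : H → H} {β γ : ℝ} {μ : ℝ≥0}
    (hBL : LipschitzWith μ B) (hβ : 0 < β) (hγ : 0 < γ) (hγμ : γ * μ < 1) {x y : ℕ → H} {z : H}
    {c : ℝ} (hV : Tendsto (lyapunov B β γ μ x y z) atTop (𝓝 c)) :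
    Bornology.IsBounded (Set.range fun n => x (n + 1)) := by
  obtain ⟨M, hM⟩ := hV.bddAbove_range
  refine (Metric.isBounded_closedBall (x := z) (r := √(M / (1 - γ * μ)))).subset ?_
  refine Set.range_subset_iff.2 fun n => mem_closedBall_iff_norm.2 (Real.le_sqrt_of_sq_le ?_)
  rw [le_div_iff₀' (sub_pos.2 hγμ)]
  exact (one_sub_mul_norm_sq_le_lyapunov hBL hβ hγ x y z n).trans (hM (Set.mem_range_self n))

lemma tendsto_norm_sub_of_tendsto_lyapunov {B : H → H} {β γ : ℝ} {μ : ℝ≥0}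
    (hBL : LipschitzWith μ B) {x y : ℕ → H} {z : H} {c : ℝ}
    (hbdd : Bornology.IsBounded (Set.range fun n => x (n + 1)))
    (hd : Tendsto (fun n => x (n + 1) - x n) atTop (𝓝 0))
    (he : Tendsto (fun n => x (n + 1) - y n) atTop (𝓝 0))
    (hV : Tendsto (lyapunov B β γ μ x y z) atTop (𝓝 c)) :
    Tendsto (fun n => ‖x (n + 1) - z‖) atTop (𝓝 √c) := by
  obtain ⟨r, hr⟩ := hbdd.subset_closedBall z
  have hinner : Tendsto (fun n => inner ℝ (x (n + 1) - x n) (B (y n) - B z)) atTop (𝓝 0) := by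
    refine squeeze_zero_norm
      (a := fun n => μ * (‖x (n + 1) - x n‖ * (r + ‖x (n + 1) - y n‖))) (fun n => ?_) ?_
    · refine (abs_inner_sub_le_of_lipschitzWith hBL _ _ _).trans ?_
      rw [← sub_sub_sub_cancel_left z (y n) (x (n + 1))]
      gcongr
      exact (norm_sub_le _ _).trans
        (add_le_add_left (mem_closedBall_iff_norm.1 (hr (Set.mem_range_self n))) _)
    · simpa using (hd.norm.mul (he.norm.const_add r)).const_mul (μ : ℝ)
  have hlim := ((hV.sub (hinner.const_mul (2 * γ))).sub ((hd.norm.pow 2).const_mul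
    (1 + γ * μ * (√2 + 1) + γ / β))).sub ((he.norm.pow 2).const_mul (γ * μ))
  simp only [norm_zero, zero_pow two_ne_zero, mul_zero, sub_zero] at hlim
  refine hlim.sqrt.congr fun n => ?_
  rw [← Real.sqrt_sq (norm_nonneg (x (n + 1) - z)), lyapunov]
  congr 1
  ring

namespace IsReflectedForwardBackward

variable {A : H → Set H} {B C : H → H} {β γ : ℝ} {μ : ℝ≥0} {x y : ℕ → H} {z : H}

lemma mem_succ (h : IsReflectedForwardBackward A B C γ x y) (hγ : γ ≠ 0) (n : ℕ) :
    γ⁻¹ • (x n - x (n + 1)) - B (y n) - C (x n) ∈ A (x (n + 1)) := by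
  have hmem := (mem_resolvent_smul_iff hγ).1 (h.succ_mem_resolvent n)
  rwa [sub_right_comm, sub_right_comm (x n), smul_sub, smul_sub, inv_smul_smul₀ hγ,
    inv_smul_smul₀ hγ] at hmem

lemma norm_sub_sq_add_norm_sub_sq_le (h : IsReflectedForwardBackward A B C γ x y)
    (hA : IsMonotone A) (hγ : 0 < γ) {u : H} (hu : u ∈ A z) (n : ℕ) :
    ‖x (n + 1) - z‖ ^ 2 + ‖x (n + 1) - x n‖ ^ 2 ≤
      ‖x n - z‖ ^ 2 - 2 * γ * inner ℝ (x (n + 1) - z) (B (y n) + C (x n) + u) := by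
  refine hA.norm_sub_sq_add_norm_sub_sq_le hγ ?_ hu
  rw [smul_add, ← sub_sub]
  exact h.succ_mem_resolvent n

lemma norm_sub_zer_sq_le (h : IsReflectedForwardBackward A B C γ x y) (hA : IsMonotone A)
    (hγ : 0 < γ) (hz : z ∈ zer (A + ofFun B + ofFun C)) (n : ℕ) :
    ‖x (n + 1) - z‖ ^ 2 + ‖x (n + 1) - x n‖ ^ 2 ≤
      ‖x n - z‖ ^ 2 - 2 * γ * inner ℝ (x (n + 1) - z) (B (y n) - B z)
        - 2 * γ * inner ℝ (x (n + 1) - z) (C (x n) - C z) := by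
  have hstep := h.norm_sub_sq_add_norm_sub_sq_le hA hγ (mem_zer_add_ofFun_add_ofFun_iff.1 hz) n
  rwa [← sub_eq_add_neg, add_sub_add_comm, inner_add_right, mul_add, ← sub_sub] at hstep

lemma succ_sub_reflected (h : IsReflectedForwardBackward A B C γ x y) (n : ℕ) :
    x (n + 2) - y (n + 1) = (x (n + 2) - x (n + 1)) - (x (n + 1) - x n) := by
  rw [h.reflected_succ, two_smul]
  abel

lemma norm_succ_sub_sq_le (h : IsReflectedForwardBackward A B C γ x y) (hA : IsMonotone A)
    (hγ : 0 < γ) (n : ℕ) :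
    ‖x (n + 2) - x (n + 1)‖ ^ 2 + ‖x (n + 2) - y (n + 1)‖ ^ 2 ≤
      ‖x (n + 1) - x n‖ ^ 2
        - 2 * γ * inner ℝ (x (n + 2) - x (n + 1)) (B (y (n + 1)) - B (y n))
        - 2 * γ * inner ℝ (x (n + 2) - x (n + 1)) (C (x (n + 1)) - C (x n)) := by
  have hstep := h.norm_sub_sq_add_norm_sub_sq_le hA hγ (h.mem_succ hγ.ne' n) (n + 1)
  have hsplit : B (y (n + 1)) + C (x (n + 1)) + (γ⁻¹ • (x n - x (n + 1)) - B (y n) - C (x n)) =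
      (B (y (n + 1)) - B (y n)) + (C (x (n + 1)) - C (x n)) - γ⁻¹ • (x (n + 1) - x n) := by
    rw [← neg_sub (x (n + 1)), smul_neg]
    abel
  have hcancel (t : ℝ) : γ * (γ⁻¹ * t) = t := mul_inv_cancel_left₀ hγ.ne' t
  rw [hsplit, inner_sub_right, inner_add_right, real_inner_smul_right, sub_self, norm_zero,
    mul_sub, mul_assoc 2 γ (γ⁻¹ * _), hcancel] at hstep
  rw [h.succ_sub_reflected, norm_sub_sq_real (x (n + 2) - x (n + 1))]
  linarith

lemma lyapunov_succ_add_le (h : IsReflectedForwardBackward A B C γ x y) (hA : IsMonotone A)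
    (hB : IsMonotone (ofFun B)) (hBL : LipschitzWith μ B) (hβ : 0 < β) (hC : IsCocoercive β C)
    (hγ : 0 < γ) (hstep : γ * μ * (√2 + 1) ≤ 1) (hz : z ∈ zer (A + ofFun B + ofFun C)) (n : ℕ) :
    lyapunov B β γ μ x y z (n + 1)
        + (1 - γ * μ * (√2 + 1) - 5 / 2 * (γ / β)) * ‖x (n + 2) - x (n + 1)‖ ^ 2 ≤
      lyapunov B β γ μ x y z n := by
  have hzer := h.norm_sub_zer_sq_le hA hγ hz (n + 1)
  have hsucc := h.norm_succ_sub_sq_le hA hγ n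
  have hBerr := mul_le_mul_of_nonneg_left
    (hB.neg_inner_add_inner_le hBL (h.reflected_succ n) (x (n + 2)) (y n) z) hγ.le
  have hCzer := mul_le_mul_of_nonneg_left
    (hC.neg_inner_sub_le_norm_sq_div hβ (x (n + 2)) (x (n + 1)) z) (by positivity : 0 ≤ 2 * γ)
  have hClag := mul_le_mul_of_nonneg_left
    (hC.neg_inner_le_add_norm_sq_div hβ (x (n + 2) - x (n + 1)) (x (n + 1)) (x n))
    (by positivity : 0 ≤ 2 * γ)
  have hdrop := mul_le_mul_of_nonneg_right hstep (sq_nonneg ‖x (n + 2) - y (n + 1)‖)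
  have hzer_coeff : 2 * γ * (‖x (n + 2) - x (n + 1)‖ ^ 2 / (4 * β)) =
      1 / 2 * (γ / β) * ‖x (n + 2) - x (n + 1)‖ ^ 2 := by
    field_simp
    ring
  have hlag_coeff : 2 * γ * ((‖x (n + 2) - x (n + 1)‖ ^ 2 + ‖x (n + 1) - x n‖ ^ 2) / (2 * β)) =
      γ / β * (‖x (n + 2) - x (n + 1)‖ ^ 2 + ‖x (n + 1) - x n‖ ^ 2) := by
    field_simp
  rw [hzer_coeff] at hCzer
  rw [hlag_coeff] at hClag
  unfold lyapunov
  linarith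

lemma tendsto_lyapunov_and_succ_sub (h : IsReflectedForwardBackward A B C γ x y)
    (hA : IsMonotone A) (hB : IsMonotone (ofFun B)) (hBL : LipschitzWith μ B) (hβ : 0 < β)
    (hC : IsCocoercive β C) (hγ : 0 < γ) (hstep : γ * (μ * (√2 + 1)) + 5 / 2 * (γ / β) < 1)
    (hz : z ∈ zer (A + ofFun B + ofFun C)) :
    (∃ c, Tendsto (lyapunov B β γ μ x y z) atTop (𝓝 c)) ∧
      Tendsto (fun n => x (n + 1) - x n) atTop (𝓝 0) := by
  set δ := 1 - γ * μ * (√2 + 1) - 5 / 2 * (γ / β) with hδ_def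
  have hδ : 0 < δ := by linarith
  have hle : γ * μ * (√2 + 1) ≤ 1 := by linarith [div_pos hγ hβ]
  have hγμ := mul_lt_one_of_mul_add_lt_one hβ hγ μ.coe_nonneg hstep
  have hV (n : ℕ) : 0 ≤ lyapunov B β γ μ x y z n :=
    (mul_nonneg (sub_pos.2 hγμ).le (sq_nonneg _)).trans
      (one_sub_mul_norm_sq_le_lyapunov hBL hβ hγ x y z n)
  obtain ⟨hlim, hsum⟩ := tendsto_of_succ_add_le hV
    (fun n => mul_nonneg hδ.le (sq_nonneg ‖x (n + 2) - x (n + 1)‖))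
    (fun n => h.lyapunov_succ_add_le hA hB hBL hβ hC hγ hle hz n)
  refine ⟨hlim, (tendsto_add_atTop_iff_nat 1).1 (tendsto_zero_iff_norm_tendsto_zero.2 ?_)⟩
  have hsq : Tendsto (fun n => ‖x (n + 2) - x (n + 1)‖ ^ 2) atTop (𝓝 0) := by
    simpa [inv_mul_cancel_left₀ hδ.ne'] using hsum.const_mul δ⁻¹
  simpa [Real.sqrt_sq] using hsq.sqrt

lemma tendsto_succ_sub_reflected (h : IsReflectedForwardBackward A B C γ x y)
    (hd : Tendsto (fun n => x (n + 1) - x n) atTop (𝓝 0)) :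
    Tendsto (fun n => x (n + 1) - y n) atTop (𝓝 0) := by
  refine (tendsto_add_atTop_iff_nat 1).1 ?_
  have hlim := ((tendsto_add_atTop_iff_nat 1).2 hd).sub hd
  rw [sub_zero] at hlim
  exact hlim.congr fun n => (h.succ_sub_reflected n).symm

lemma exists_tendsto_norm_sub (h : IsReflectedForwardBackward A B C γ x y) (hA : IsMonotone A)
    (hB : IsMonotone (ofFun B)) (hBL : LipschitzWith μ B) (hβ : 0 < β) (hC : IsCocoercive β C)
    (hγ : 0 < γ) (hstep : γ * (μ * (√2 + 1)) + 5 / 2 * (γ / β) < 1)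
    (hz : z ∈ zer (A + ofFun B + ofFun C)) :
    ∃ r, Tendsto (fun n => ‖x (n + 1) - z‖) atTop (𝓝 r) := by
  obtain ⟨⟨c, hV⟩, hd⟩ := h.tendsto_lyapunov_and_succ_sub hA hB hBL hβ hC hγ hstep hz
  have hγμ := mul_lt_one_of_mul_add_lt_one hβ hγ μ.coe_nonneg hstep
  have hbdd := isBounded_range_of_tendsto_lyapunov hBL hβ hγ hγμ hV
  exact ⟨√c, tendsto_norm_sub_of_tendsto_lyapunov hBL hbdd hd (h.tendsto_succ_sub_reflected hd) hV⟩

lemma tendsto_residual (h : IsReflectedForwardBackward A B C γ x y) {K : ℝ≥0}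
    (hBL : LipschitzWith μ B) (hCL : LipschitzWith K C)
    (hd : Tendsto (fun n => x (n + 1) - x n) atTop (𝓝 0)) :
    Tendsto (fun n => γ⁻¹ • (x n - x (n + 1)) - B (y n) - C (x n)
      + (B (x (n + 1)) + C (x (n + 1)))) atTop (𝓝 0) := by
  have hBlim := tendsto_sub_of_lipschitzWith hBL (h.tendsto_succ_sub_reflected hd)
  have hClim := tendsto_sub_of_lipschitzWith hCL hd
  have hlim := (hBlim.add hClim).sub (hd.const_smul γ⁻¹)
  rw [add_zero, smul_zero, sub_zero] at hlim
  refine hlim.congr fun n => ?_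
  rw [← neg_sub (x (n + 1)), smul_neg]
  abel

lemma mem_zer_of_mapClusterPt [CompleteSpace H] (h : IsReflectedForwardBackward A B C γ x y)
    (hA : IsMaximallyMonotone A) (hB : IsMonotone (ofFun B)) (hBL : LipschitzWith μ B)
    (hβ : 0 < β) (hC : IsCocoercive β C) (hγ : γ ≠ 0)
    (hbdd : Bornology.IsBounded (Set.range fun n => x (n + 1)))
    (hd : Tendsto (fun n => x (n + 1) - x n) atTop (𝓝 0)) {w : H}
    (hw : MapClusterPt (toWeakSpace ℝ H w) atTop fun n => toWeakSpace ℝ H (x (n + 1))) :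
    w ∈ zer (A + ofFun B + ofFun C) := by
  have hCL := hC.lipschitzWith hβ
  exact mem_zer_add_ofFun_add_ofFun_iff.2 <|
    hA.neg_mem_of_mapClusterPt (hB.ofFun_add (hC.isMonotone hβ.le)) (hBL.add hCL)
      (h.mem_succ hγ) hbdd (h.tendsto_residual hBL hCL hd) hw

end IsReflectedForwardBackward

end MonotoneOperator

theorem theorem2 {H : Type*} [NormedAddCommGroup H] [InnerProductSpace ℝ H] [CompleteSpace H]
    (A : H → Set H) (B C : H → H) (μ : ℝ≥0) (β ζ ξ γ : ℝ)
    (hA : MonotoneOperator.IsMaximallyMonotone A)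
    (hμ : 0 < μ)
    (hB : MonotoneOperator.IsMonotone (MonotoneOperator.ofFun B))
    (hBL : LipschitzWith μ B)
    (hβ : 0 < β)
    (hC : MonotoneOperator.IsCocoercive β C)
    (hzer : (MonotoneOperator.zer
      (A + MonotoneOperator.ofFun B + MonotoneOperator.ofFun C)).Nonempty)
    (hζ : ζ ∈ Set.Ioo (0 : ℝ) (1 / 2))
    (hξ : 0 < ξ)
    (hγ : 0 < γ)
    (hγ₁ : γ < (1 - ζ) / μ)
    (hγ₂ : γ < 4 * β * ζ / (1 + ξ))
    (hγ₃ : γ < (√2 - 1) / μ)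
    (hγ₄ : γ < (1 - 2 * ζ) / (μ * (√2 + 1) + 2 / (β * ξ)))
    (x_neg_one : H) (x y : ℕ → H)
    (hy_zero : y 0 = (2 : ℝ) • x 0 - x_neg_one)
    (hy_succ : ∀ n, y (n + 1) = (2 : ℝ) • x (n + 1) - x n)
    (hx : ∀ n, x (n + 1) ∈
      MonotoneOperator.resolvent (γ • A) (x n - γ • B (y n) - γ • C (x n))) :
    ∃ x_bar ∈ MonotoneOperator.zer
        (A + MonotoneOperator.ofFun B + MonotoneOperator.ofFun C),
      Tendsto (fun n => toWeakSpace ℝ H (x n)) atTop (𝓝 (toWeakSpace ℝ H x_bar)) := by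
  have hstep : γ * (μ * (√2 + 1)) + 5 / 2 * (γ / β) < 1 :=
    MonotoneOperator.mul_add_lt_one_of_lt_div (by positivity) hβ hξ hγ hγ₂ hγ₄
  have hγμ := MonotoneOperator.mul_lt_one_of_mul_add_lt_one hβ hγ μ.coe_nonneg hstep
  have hxy : MonotoneOperator.IsReflectedForwardBackward A B C γ x y := ⟨hy_succ, hx⟩
  obtain ⟨z, hz⟩ := hzer
  obtain ⟨⟨c, hV⟩, hd⟩ :=
    hxy.tendsto_lyapunov_and_succ_sub hA.1 hB hBL hβ hC hγ hstep hz
  have hbdd := MonotoneOperator.isBounded_range_of_tendsto_lyapunov hBL hβ hγ hγμ hV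
  obtain ⟨x_bar, hx_bar, hlim⟩ :=
    MonotoneOperator.exists_tendsto_toWeakSpace_of_tendsto_norm_sub ⟨z, hz⟩
      (fun z' hz' => hxy.exists_tendsto_norm_sub hA.1 hB hBL hβ hC hγ hstep hz')
      (fun w hw => hxy.mem_zer_of_mapClusterPt hA hB hBL hβ hC hγ.ne' hbdd hd hw)
  exact ⟨x_bar, hx_bar, (tendsto_add_atTop_iff_nat 1).1 hlim⟩
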